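/- Assume the Generalized Continuum Hypothesis ($2^{\mu}=\mu^{+}$ for every infinite cardinal $\mu$), and let $\kappa,\lambda$ be cardinals with $\omega_2\le\kappa\le\lambda$. A hypergraph is identified with the family $\mathcal E$ of its edges, which are non-empty sets; its vertex set is $\bigcup\mathcal E$. Let $V$ be a set of cardinality $\lambda$ and let $\mathcal E$ be a hypergraph of subsets of $V$ such that $|E\cap E'|<\omega$ for any two distinct edges $E,E'\in\mathcal E$ (property $C(2,\omega)$). (1) If every edge of $\mathcal E$ has cardinality $\kappa$, then $\mathcal E$ has a maximizing well-ordering, i.e. there is a well-ordering $\preceq$ of $\bigcup\mathcal E$ such that every $E\in\mathcal E$ has a $\preceq$-maximal element. (2) If every edge of $\mathcal E$ is either finite or of cardinality $\kappa$ (that is, $\mathcal E\subseteq[V]^{\omega\cup\{\kappa\}}$), then $\mathcal E$ has a minimal vertex cover, i.e. there is a set $Z\subseteq\bigcup\mathcal E$ that meets every $E\in\mathcal E$, while no proper subset of $Z$ meets every $E\in\mathcal E$. -/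

import Mathlib

universe u

namespace EdgeFamily

open Cardinal

/-- The generalized continuum hypothesis (for the cardinals of the universe `u`). -/
def GCH : Prop :=
  ∀ c : Cardinal.{u}, ℵ₀ ≤ c → (2 : Cardinal.{u}) ^ c = Order.succ c

variable {V : Type u}

/-- `[V]^S`: the subsets of `V` whose cardinality belongs to `S`. -/
def subsetsOfCard (V : Type u) (S : Set Cardinal.{u}) : Set (Set V) :=
  {B | #B ∈ S}

/-- A hypergraph is identified with the family `E` of its edges, which are non-empty sets;
its vertex set is `⋃₀ E`. -/
def IsHypergraph (E : Set (Set V)) : Prop :=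
  ∀ e ∈ E, e.Nonempty

/-- Property `C(k, ρ)`: the intersection of any `k` distinct edges has fewer than `ρ` elements. -/
def PropertyC (E : Set (Set V)) (k : ℕ) (ρ : Cardinal.{u}) : Prop :=
  ∀ E' : Set (Set V), E' ⊆ E → #E' = k → #(⋂₀ E' : Set V) < ρ

/-- `Y` is a vertex cover of `E`: a set of vertices that meets every edge. -/
def IsVertexCover (E : Set (Set V)) (Y : Set V) : Prop :=
  Y ⊆ ⋃₀ E ∧ ∀ e ∈ E, (Y ∩ e).Nonempty

/-- `Z` is a vertex cover no proper subset of which is a vertex cover. -/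
def IsMinimalVertexCover (E : Set (Set V)) (Z : Set V) : Prop :=
  IsVertexCover E Z ∧ ∀ Z' : Set V, Z' ⊂ Z → ¬ IsVertexCover E Z'

/-- `r` is (the strict part of) a well-ordering of the vertex set of `E` for which every edge
has a maximal element. -/
def IsMaximizingWellOrder (E : Set (Set V)) (r : ↥(⋃₀ E) → ↥(⋃₀ E) → Prop) : Prop :=
  IsWellOrder ↥(⋃₀ E) r ∧
    ∀ e ∈ E, ∃ m : ↥(⋃₀ E), (m : V) ∈ e ∧ ∀ x : ↥(⋃₀ E), (x : V) ∈ e → ¬ r m x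

/-- `M(lam, S, k, ρ) → MinVC`: every hypergraph `E ⊆ [V]^S` with property `C(k, ρ)`, where `V` is
a set of cardinality `lam`, has a minimal vertex cover. -/
def MinVC (lam : Cardinal.{u}) (S : Set Cardinal.{u}) (k : ℕ) (ρ : Cardinal.{u}) : Prop :=
  ∀ V : Type u, #V = lam → ∀ E : Set (Set V), IsHypergraph E → E ⊆ subsetsOfCard V S →
    PropertyC E k ρ → ∃ Z : Set V, IsMinimalVertexCover E Z

/-- `M(lam, S, k, ρ) → MaxWO`: every hypergraph `E ⊆ [V]^S` with property `C(k, ρ)`, where `V` is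
a set of cardinality `lam`, has a maximizing well-ordering. -/
def MaxWO (lam : Cardinal.{u}) (S : Set Cardinal.{u}) (k : ℕ) (ρ : Cardinal.{u}) : Prop :=
  ∀ V : Type u, #V = lam → ∀ E : Set (Set V), IsHypergraph E → E ⊆ subsetsOfCard V S →
    PropertyC E k ρ → ∃ r : ↥(⋃₀ E) → ↥(⋃₀ E) → Prop, IsMaximizingWellOrder E r

end EdgeFamily

namespace EdgeFamily

open Cardinal Set

/-! Both parts rest on one well-order of `V` in which every edge of size κ has a maximum, built by
induction on the size μ of a set containing the edges. If μ ≤ κ, GCH leaves at most κ edges, and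
each has a point outside the earlier ones. If μ > κ, an increasing chain of fewer-than-μ-sized
edge-closed sets covers the vertices. As κ > ℵ₁, each edge meets some member uncountably; it lies
inside the first such member, yet loses at most ℵ₁ points to the earlier ones. The remainders still
have size κ, so induction orders each layer. For covers, finite edges have maxima in any linear
order, and a greedy choice along the well-order is minimal. -/

/-- The lexicographic combination of a rank function into a well-order with a well-order for
each rank. -/
def stackRel {V : Type*} {ι : Type*} [LT ι] (L : V → ι) (r : ι → V → V → Prop) (x y : V) : Prop :=
  L x < L y ∨ L x = L y ∧ r (L x) x y

theorem isWellOrder_stackRel {V : Type*} {ι : Type*} [LinearOrder ι] [WellFoundedLT ι]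
    (L : V → ι) (r : ι → V → V → Prop) (hr : ∀ i, IsWellOrder V (r i)) :
    IsWellOrder V (stackRel L r) := by
  have hwf : WellFounded (stackRel L r) := by
    refine ⟨fun x => ?_⟩
    obtain ⟨i, hi⟩ : ∃ i, L x = i := ⟨_, rfl⟩
    induction i using WellFoundedLT.induction generalizing x with
    | ind i ih =>
      induction x using (hr i).wf.induction with
      | h x ihx =>
        refine ⟨x, fun y hy => ?_⟩
        rcases hy with hy | ⟨hy, hyx⟩
        · exact ih (L y) (hi ▸ hy) y rfl
        · exact ihx y (by rw [← hi, ← hy]; exact hyx) (hy.trans hi)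
  have htri : Std.Trichotomous (stackRel L r) := by
    refine ⟨fun x y hxy hyx => ?_⟩
    simp only [stackRel, not_or, not_and, not_lt] at hxy hyx
    have h : L x = L y := le_antisymm hyx.1 hxy.1
    have := hr (L x)
    exact Std.Trichotomous.trichotomous (r := r (L x)) x y (hxy.2 h)
      (by rw [h]; exact hyx.2 h.symm)
  exact { wf := hwf, trichotomous := htri.trichotomous }

theorem exists_isWellOrder_forall_not_rel {V : Type*} (m : V) :
    ∃ r : V → V → Prop, IsWellOrder V r ∧ ∀ x, ¬ r m x := by
  classical
  refine ⟨stackRel (fun x => if x = m then (1 : ℕ) else 0) fun _ => WellOrderingRel,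
    isWellOrder_stackRel _ _ fun _ => WellOrderingRel.isWellOrder, fun x => ?_⟩
  rintro (h | ⟨h, hr⟩)
  · simp only [if_true] at h
    split_ifs at h <;> omega
  · by_cases hx : x = m
    · subst hx
      exact irrefl_of WellOrderingRel x hr
    · simp [hx] at h

/-- Well-orders of layers that maximize the traces of the edges combine to one that maximizes
the edges. -/
theorem exists_isWellOrder_of_layers {V : Type*} {ι : Type*} [LinearOrder ι] [WellFoundedLT ι]
    (C : ι → Set V) (E : Set (Set V)) (idx : Set V → ι)
    (hsub : ∀ e ∈ E, e ⊆ ⋃ j ≤ idx e, C j)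
    (hr : ∀ i, ∃ r : V → V → Prop, IsWellOrder V r ∧ ∀ e ∈ E, idx e = i →
      ∃ m ∈ e \ ⋃ j < i, C j, ∀ x ∈ e \ ⋃ j < i, C j, ¬ r m x) :
    ∃ r : V → V → Prop, IsWellOrder V r ∧ ∀ e ∈ E, ∃ m ∈ e, ∀ x ∈ e, ¬ r m x := by
  classical
  rcases E.eq_empty_or_nonempty with rfl | ⟨e₀, -⟩
  · exact ⟨WellOrderingRel, WellOrderingRel.isWellOrder, by simp⟩
  choose r hwo hmax using hr
  -- Points in no layer lie in no edge, so their default rank is harmless.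
  let L : V → ι := fun x =>
    if h : ∃ i, x ∈ C i then wellFounded_lt.min {i | x ∈ C i} h else idx e₀
  have hLmem : ∀ {x i}, x ∈ C i → x ∈ C (L x) ∧ L x ≤ i := by
    intro x i hx
    have h : ∃ i, x ∈ C i := ⟨i, hx⟩
    simp only [L, dif_pos h]
    exact ⟨wellFounded_lt.min_mem {i | x ∈ C i} h,
      WellFounded.min_le (s := {i | x ∈ C i}) wellFounded_lt hx⟩
  have hLe : ∀ e ∈ E, ∀ x ∈ e, x ∈ C (L x) ∧ L x ≤ idx e := by
    intro e he x hx
    obtain ⟨j, hj, hxj⟩ := mem_iUnion₂.1 (hsub e he hx)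
    exact ⟨(hLmem hxj).1, (hLmem hxj).2.trans hj⟩
  refine ⟨stackRel L r, isWellOrder_stackRel L r hwo, fun e he => ?_⟩
  obtain ⟨m, ⟨hme, hm⟩, hmx⟩ := hmax (idx e) e he rfl
  have hLm : L m = idx e := by
    refine le_antisymm (hLe e he m hme).2 (not_lt.1 fun hlt => hm ?_)
    exact mem_iUnion₂.2 ⟨_, hlt, (hLe e he m hme).1⟩
  refine ⟨m, hme, fun x hx => ?_⟩
  rintro (h | ⟨h, hrel⟩)
  · exact absurd (hLe e he x hx).2 (not_le.2 (hLm ▸ h))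
  · rw [hLm] at h hrel
    refine hmx x ⟨hx, fun hx' => ?_⟩ hrel
    obtain ⟨j, hj, hxj⟩ := mem_iUnion₂.1 hx'
    exact absurd ((hLmem hxj).2.trans_lt hj) (by rw [← h]; exact lt_irrefl _)

/-! ### Chains of countable sets and counting edges under GCH -/

/-- A union of a chain of countable sets has cardinality at most `ℵ₁`. -/
theorem mk_iUnion_le_aleph_one_of_monotone {V : Type u} {ι : Type*} [LinearOrder ι]
    (s : ι → Set V) (hs : Monotone s) (hc : ∀ i, (s i).Countable) :
    #(⋃ i, s i) ≤ aleph.{u} 1 := by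
  by_contra! h
  obtain ⟨T, hT, hTc⟩ := le_mk_iff_exists_subset.1 h.le
  choose i hi using fun t : T => mem_iUnion.1 (hT t.2)
  have hU : #(⋃ t : T, s (i t)) ≤ aleph.{u} 1 := by
    refine (mk_iUnion_le _).trans ?_
    rw [hTc]
    refine mul_le_of_le (aleph0_le_aleph 1) le_rfl (ciSup_le' fun t => ?_)
    exact (le_aleph0_iff_set_countable.2 (hc _)).trans (aleph0_le_aleph 1)
  -- A member of the chain containing `x` lies above all those chosen for `T`, so it swallows the
  -- uncountable `T`.
  obtain ⟨x, hx, hxU⟩ := sdiff_nonempty_of_mk_lt_mk (hU.trans_lt h)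
  obtain ⟨j, hj⟩ := mem_iUnion.1 hx
  have hTj : T ⊆ s j := by
    intro t ht
    rcases le_total (i ⟨t, ht⟩) j with hle | hle
    · exact hs hle (hi ⟨t, ht⟩)
    · exact absurd (mem_iUnion.2 ⟨⟨t, ht⟩, hs hle hj⟩) hxU
  have := le_aleph0_iff_set_countable.2 ((hc j).mono hTj)
  rw [hTc] at this
  exact this.not_gt aleph0_lt_aleph_one

/-- Otherwise a countably infinite `T ⊆ X` has only countably many points of `X` below or at its
members, and a point of `X` above all of `T` has an infinite trace below it. -/
theorem exists_infinite_inter_Iio {ι : Type*} [LinearOrder ι] {X : Set ι}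
    (hX : ¬ X.Countable) : ∃ i, (X ∩ Iio i).Infinite := by
  by_contra! h
  have hinf : X.Infinite := fun hf => hX hf.countable
  obtain ⟨T, hTX, hTc, hTinf⟩ := hinf.exists_subset_countable_infinite
  have hU : (⋃ t ∈ T, X ∩ Iic t).Countable := by
    refine hTc.biUnion fun t _ => (((h t).insert t).subset ?_).countable
    rintro y ⟨hy, hyt⟩
    rcases (mem_Iic.1 hyt).eq_or_lt with rfl | hlt
    · exact mem_insert _ _
    · exact mem_insert_of_mem _ ⟨hy, hlt⟩
  obtain ⟨x, hx, hxU⟩ := not_subset.1 fun hsub => hX (hU.mono hsub)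
  refine hTinf ((h x).subset fun t ht => ⟨hTX ht, ?_⟩)
  exact not_le.1 fun hle => hxU (mem_iUnion₂.2 ⟨t, ht, hx, hle⟩)

theorem GCH.two_power_le (hGCH : GCH.{u}) {c ν : Cardinal.{u}} (hν : ℵ₀ < ν) (hc : c < ν) :
    2 ^ c ≤ ν :=
  calc (2 : Cardinal.{u}) ^ c ≤ 2 ^ max ℵ₀ c := power_le_power_left two_ne_zero (le_max_right _ _)
    _ = Order.succ (max ℵ₀ c) := hGCH _ (le_max_left _ _)
    _ ≤ ν := Order.succ_le_of_lt (max_lt hν hc)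

theorem mk_Iio_ord_lt {c : Cardinal.{u}} (i : c.ord.ToType) : #(Iio i) < c :=
  (mk_Iio_lt i (by simp)).trans_eq (mk_ord_toType c)

/-- Under GCH, at most `ν` edges of an almost disjoint family meet a given set of size `ν` in an
uncountable set: such an edge is determined by an infinite trace on a proper initial segment. -/
theorem mk_edges_le (hGCH : GCH.{u}) {V : Type u} {E : Set (Set V)}
    (hE : E.Pairwise fun e f => (e ∩ f).Finite) {ν : Cardinal.{u}} (hν : ℵ₀ < ν) {B : Set V}
    (hB : #B ≤ ν) : #{e | e ∈ E ∧ ¬ (e ∩ B).Countable} ≤ ν := by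
  obtain ⟨g⟩ : Nonempty (B ↪ ν.ord.ToType) := by
    rw [← Cardinal.le_def]; simpa using hB
  let X : Set V → Set ν.ord.ToType := fun e => g '' {x : B | (x : V) ∈ e}
  have hX : ∀ e : {e | e ∈ E ∧ ¬ (e ∩ B).Countable}, ¬ (X e).Countable := by
    rintro ⟨e, he, hc⟩ h
    refine hc (((h.preimage g.injective).image Subtype.val).mono ?_)
    rintro x ⟨hx, hxB⟩
    exact ⟨⟨x, hxB⟩, ⟨⟨x, hxB⟩, hx, rfl⟩, rfl⟩
  choose i hi using fun e => exists_infinite_inter_Iio (hX e)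
  have hinj : Function.Injective fun e : {e | e ∈ E ∧ ¬ (e ∩ B).Countable} =>
      (⟨i e, {y | (y : ν.ord.ToType) ∈ X e}⟩ : Σ i : ν.ord.ToType, Set (Iio i)) := by
    intro e f hef
    by_contra hne
    have hfin := hE e.2.1 f.2.1 fun h => hne (Subtype.ext h)
    have himg : X e ∩ Iio (i e) ⊆ g '' (Subtype.val ⁻¹' ((e : Set V) ∩ f)) := by
      have key : ∀ (a b : ν.ord.ToType) (s t : Set ν.ord.ToType),
          (⟨a, {y | (y : ν.ord.ToType) ∈ s}⟩ : Σ i : ν.ord.ToType, Set (Iio i)) =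
            ⟨b, {y | (y : ν.ord.ToType) ∈ t}⟩ → s ∩ Iio a ⊆ t := by
        intro a b s t h
        obtain ⟨rfl, h⟩ := Sigma.mk.inj_iff.1 h
        rintro y ⟨hy, hya⟩
        exact (Set.ext_iff.1 (eq_of_heq h) ⟨y, hya⟩).1 hy
      intro y hy
      obtain ⟨z, hz, rfl⟩ := key _ _ _ _ hef hy
      obtain ⟨z', hz', hzz⟩ := hy.1
      rw [g.injective hzz] at hz'
      exact ⟨z, ⟨hz', hz⟩, rfl⟩
    exact hi e (((hfin.preimage Subtype.val_injective.injOn).image g).subset himg)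
  refine (mk_le_of_injective hinj).trans ?_
  rw [mk_sigma]
  refine (sum_le_mk_mul_iSup _).trans ?_
  refine mul_le_of_le hν.le (by simp) (ciSup_le' fun a => ?_)
  rw [mk_set]
  exact hGCH.two_power_le hν (mk_Iio_ord_lt a)

/-! ### Edge-closed sets -/

/-- `A` contains every edge that it meets in an uncountable set. -/
def IsEdgeClosed {V : Type*} (E : Set (Set V)) (A : Set V) : Prop :=
  ∀ e ∈ E, ¬ (e ∩ A).Countable → e ⊆ A

theorem exists_isEdgeClosed (hGCH : GCH.{u}) {V : Type u} {E : Set (Set V)}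
    (hE : E.Pairwise fun e f => (e ∩ f).Finite) {ν : Cardinal.{u}} (hν : ℵ₀ < ν)
    (hcard : ∀ e ∈ E, #e ≤ ν) {B : Set V} (hB : #B ≤ ν) :
    ∃ A, B ⊆ A ∧ IsEdgeClosed E A ∧ #A ≤ ν := by
  let step : Set V → Set V := fun A => A ∪ ⋃₀ {e | e ∈ E ∧ ¬ (e ∩ A).Countable}
  have hstep : ∀ A : Set V, #A ≤ ν → #(step A) ≤ ν := by
    intro A hA
    refine (mk_union_le _ _).trans (add_le_of_le hν.le hA ((mk_sUnion_le _).trans ?_))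
    exact mul_le_of_le hν.le (mk_edges_le hGCH hE hν hA) (ciSup_le' fun e => hcard _ e.2.1)
  have hiter : ∀ n, #(step^[n] B) ≤ ν := by
    intro n
    induction n with
    | zero => exact hB
    | succ n ih => rw [Function.iterate_succ_apply']; exact hstep _ ih
  refine ⟨⋃ n, step^[n] B, subset_iUnion (fun n => step^[n] B) 0, fun e he hc => ?_, ?_⟩
  · rw [inter_iUnion] at hc
    -- Closure needs only ω steps: an uncountable trace on the union is already uncountable at a
    -- finite stage.
    obtain ⟨n, hn⟩ : ∃ n, ¬ (e ∩ step^[n] B).Countable := by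
      by_contra! h
      exact hc (countable_iUnion h)
    refine Subset.trans ?_ (subset_iUnion (fun n => step^[n] B) (n + 1))
    rw [Function.iterate_succ_apply']
    exact (subset_sUnion_of_mem (show e ∈ {e | e ∈ E ∧ ¬ (e ∩ step^[n] B).Countable} from
      ⟨he, hn⟩)).trans subset_union_right
  · have h := mk_iUnion_le_lift.{u, 0} fun n => step^[n] B
    simp only [lift_uzero, mk_nat, lift_aleph0] at h
    exact h.trans (mul_le_of_le hν.le hν.le (ciSup_le' hiter))

/-- The least edge-closed set containing `B`. -/
def edgeClosure {V : Type*} (E : Set (Set V)) (B : Set V) : Set V :=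
  ⋂₀ {A | B ⊆ A ∧ IsEdgeClosed E A}

theorem subset_edgeClosure {V : Type*} (E : Set (Set V)) (B : Set V) : B ⊆ edgeClosure E B :=
  subset_sInter fun _ h => h.1

theorem isEdgeClosed_edgeClosure {V : Type*} (E : Set (Set V)) (B : Set V) :
    IsEdgeClosed E (edgeClosure E B) := fun e he hc =>
  subset_sInter fun _ h => h.2 e he fun hc' =>
    hc (hc'.mono (inter_subset_inter_right _ (sInter_subset_of_mem h)))

theorem edgeClosure_subset {V : Type*} {E : Set (Set V)} {A B : Set V} (hBA : B ⊆ A)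
    (hA : IsEdgeClosed E A) : edgeClosure E B ⊆ A :=
  fun _ hx => hx A ⟨hBA, hA⟩

theorem edgeClosure_mono {V : Type*} (E : Set (Set V)) : Monotone (edgeClosure E) := fun _ B h =>
  edgeClosure_subset (h.trans (subset_edgeClosure E B)) (isEdgeClosed_edgeClosure E B)

theorem mk_edgeClosure_le (hGCH : GCH.{u}) {V : Type u} {E : Set (Set V)}
    (hE : E.Pairwise fun e f => (e ∩ f).Finite) {ν : Cardinal.{u}} (hν : ℵ₀ < ν)
    (hcard : ∀ e ∈ E, #e ≤ ν) {B : Set V} (hB : #B ≤ ν) : #(edgeClosure E B) ≤ ν := by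
  obtain ⟨A, hBA, hA, hAν⟩ := exists_isEdgeClosed hGCH hE hν hcard hB
  exact (mk_le_mk_of_subset (edgeClosure_subset hBA hA)).trans hAν

theorem mk_sdiff_eq_of_mk_inter_lt {V : Type u} {e A : Set V} (he : ℵ₀ ≤ #e)
    (h : #(e ∩ A : Set V) < #e) : #(e \ A : Set V) = #e := by
  have h1 : #(e \ A : Set V) + #(e ∩ A : Set V) = #e := by
    rw [← mk_sdiff_add_mk (inter_subset_left : e ∩ A ⊆ e), sdiff_self_inter]
  exact eq_of_add_eq_of_aleph0_le ((add_comm _ _).trans h1) h he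

/-! ### Well-orders maximizing the edges of size κ -/

theorem exists_isWellOrder_of_mk_le {V : Type u} {κ : Cardinal.{u}} (hκ : ℵ₀ < κ)
    {E : Set (Set V)} (hE : E.Pairwise fun e f => (e ∩ f).Finite) (hcard : ∀ e ∈ E, #e = κ)
    (hEκ : #E ≤ κ) :
    ∃ r : V → V → Prop, IsWellOrder V r ∧ ∀ e ∈ E, ∃ m ∈ e, ∀ x ∈ e, ¬ r m x := by
  classical
  rcases E.eq_empty_or_nonempty with rfl | ⟨e₀, he₀⟩
  · exact ⟨WellOrderingRel, WellOrderingRel.isWellOrder, by simp⟩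
  obtain ⟨g⟩ : Nonempty (E ↪ κ.ord.ToType) := by
    rw [← Cardinal.le_def]; simpa using hEκ
  let idx : Set V → κ.ord.ToType := fun e => if h : e ∈ E then g ⟨e, h⟩ else g ⟨e₀, he₀⟩
  have hidx : ∀ {e f}, e ∈ E → f ∈ E → idx e = idx f → e = f := by
    intro e f he hf h
    simp only [idx, dif_pos he, dif_pos hf] at h
    exact congrArg Subtype.val (g.injective h)
  let C : κ.ord.ToType → Set V := fun i => ⋃₀ {e | e ∈ E ∧ idx e = i}
  have hC : ∀ {e}, e ∈ E → C (idx e) = e := by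
    intro e he
    refine Subset.antisymm (sUnion_subset ?_) (subset_sUnion_of_mem ⟨he, rfl⟩)
    rintro f ⟨hf, h⟩
    exact (hidx hf he h).subset
  refine exists_isWellOrder_of_layers C E idx (fun e he => ?_) fun i => ?_
  · refine Subset.trans (hC he).superset ?_
    exact subset_iUnion₂ (s := fun j (_ : j ≤ idx e) => C j) (idx e) le_rfl
  by_cases h : ∃ e ∈ E, idx e = i
  · obtain ⟨e, he, rfl⟩ := h
    -- Fewer than κ earlier edges each remove finitely many points.
    have hlt : #(e ∩ ⋃ j < idx e, C j : Set V) < #e := by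
      have hfin : ∀ j ∈ Iio (idx e), #(e ∩ C j : Set V) ≤ ℵ₀ := by
        intro j hj
        by_cases h : ∃ f ∈ E, idx f = j
        · obtain ⟨f, hf, rfl⟩ := h
          rw [hC hf]
          exact (lt_aleph0_iff_set_finite.2
            (hE he hf (by rintro rfl; exact lt_irrefl _ (mem_Iio.1 hj)))).le
        · have : C j = ∅ := by
            refine sUnion_eq_empty.2 ?_
            rintro f ⟨hf, hfj⟩
            exact absurd ⟨f, hf, hfj⟩ h
          simp [this]
      rw [inter_iUnion₂]
      refine (mk_biUnion_le (fun j => e ∩ C j) (Iio (idx e))).trans_lt ?_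
      rw [hcard e he]
      refine (mul_le_mul_right (ciSup_le' fun j : Iio (idx e) => hfin j j.2) _).trans_lt ?_
      exact mul_lt_of_lt hκ.le (mk_Iio_ord_lt _) hκ
    obtain ⟨m, hm⟩ : (e \ ⋃ j < idx e, C j).Nonempty := by
      rw [← mk_set_ne_zero_iff, mk_sdiff_eq_of_mk_inter_lt (hcard e he ▸ hκ.le) hlt, hcard e he]
      exact (aleph0_pos.trans hκ).ne'
    obtain ⟨r, hr, hmax⟩ := exists_isWellOrder_forall_not_rel m
    refine ⟨r, hr, fun f hf hfe => ?_⟩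
    obtain rfl := hidx hf he hfe
    exact ⟨m, hm, fun x _ => hmax x⟩
  · exact ⟨WellOrderingRel, WellOrderingRel.isWellOrder, fun e he hi => absurd ⟨e, he, hi⟩ h⟩

theorem exists_isWellOrder_of_subset (hGCH : GCH.{u}) {V : Type u} {κ : Cardinal.{u}}
    (hκ : aleph 2 ≤ κ) (W : Set V) (E : Set (Set V))
    (hE : E.Pairwise fun e f => (e ∩ f).Finite) (hcard : ∀ e ∈ E, #e = κ)
    (hW : ∀ e ∈ E, e ⊆ W) :
    ∃ r : V → V → Prop, IsWellOrder V r ∧ ∀ e ∈ E, ∃ m ∈ e, ∀ x ∈ e, ¬ r m x := by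
  classical
  have h1κ : aleph 1 < κ := (aleph_lt_aleph.2 one_lt_two).trans_le hκ
  have h0κ : ℵ₀ < κ := aleph0_lt_aleph_one.trans h1κ
  obtain ⟨μ, hμ⟩ : ∃ μ, #W = μ := ⟨_, rfl⟩
  induction μ using WellFoundedLT.induction generalizing W E with
  | ind μ ih =>
  have hunc : ∀ e ∈ E, ¬ e.Countable := fun e he hc =>
    (le_aleph0_iff_set_countable.2 hc).not_gt (hcard e he ▸ h0κ)
  rcases le_or_gt μ κ with hle | hlt
  · refine exists_isWellOrder_of_mk_le h0κ hE hcard ((mk_le_mk_of_subset ?_).trans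
      (mk_edges_le hGCH hE h0κ (hμ.trans_le hle)))
    exact fun e he => ⟨he, by rw [inter_eq_left.2 (hW e he)]; exact hunc e he⟩
  obtain ⟨g⟩ : Nonempty (W ≃ μ.ord.ToType) := by
    rw [← Cardinal.eq]; simpa using hμ
  let C : μ.ord.ToType → Set V := fun i => edgeClosure E ((fun j => (g.symm j : V)) '' Iic i)
  have hCmono : Monotone C := fun i j hij =>
    edgeClosure_mono E (image_mono (Iic_subset_Iic.2 hij))
  have hCcard : ∀ i, #(C i) < μ := by
    intro i
    have hi : #(Iic i) < μ := by
      rw [← Iio_insert]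
      refine (mk_insert_le).trans_lt ?_
      exact add_lt_of_lt (h0κ.trans hlt).le (mk_Iio_ord_lt i)
        (one_lt_aleph0.trans (h0κ.trans hlt))
    refine (mk_edgeClosure_le hGCH hE (h0κ.trans_le (le_max_left κ #(Iic i)))
      (fun e he => (hcard e he).trans_le (le_max_left _ _))
      (mk_image_le.trans (le_max_right _ _))).trans_lt (max_lt hlt hi)
  have hWC : W ⊆ ⋃ i, C i := fun x hx =>
    mem_iUnion.2 ⟨g ⟨x, hx⟩, subset_edgeClosure _ _ ⟨g ⟨x, hx⟩, mem_Iic.2 le_rfl, by simp⟩⟩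
  have hex : ∀ e ∈ E, ∃ i, ¬ (e ∩ C i).Countable ∧ ∀ j < i, (e ∩ C j).Countable := by
    intro e he
    have hne : {i | ¬ (e ∩ C i).Countable}.Nonempty := by
      by_contra! h
      have hc : ∀ i, (e ∩ C i).Countable := fun i => by
        by_contra hi
        exact (Set.ext_iff.1 h i).1 hi
      have := mk_iUnion_le_aleph_one_of_monotone (fun i => e ∩ C i)
        (fun i j hij => inter_subset_inter_right _ (hCmono hij)) hc
      rw [← inter_iUnion, inter_eq_left.2 ((hW e he).trans hWC), hcard e he] at this
      exact this.not_gt h1κ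
    refine ⟨wellFounded_lt.min _ hne, wellFounded_lt.min_mem _ hne, fun j hj => ?_⟩
    by_contra hjc
    exact WellFounded.not_lt_min wellFounded_lt {i | ¬ (e ∩ C i).Countable} hjc hj
  have : Nonempty μ.ord.ToType := by
    rw [← mk_ne_zero_iff, mk_ord_toType]
    exact (aleph0_pos.trans (h0κ.trans hlt)).ne'
  choose! idx hidx hidx' using hex
  refine exists_isWellOrder_of_layers C E idx (fun e he => ?_) fun i => ?_
  · refine Subset.trans (isEdgeClosed_edgeClosure E _ e he (hidx e he)) ?_
    exact subset_iUnion₂ (s := fun j (_ : j ≤ idx e) => C j) (idx e) le_rfl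
  have htrace : ∀ e ∈ E, #(e \ ⋃ j < idx e, C j : Set V) = κ := by
    intro e he
    rw [mk_sdiff_eq_of_mk_inter_lt (hcard e he ▸ h0κ.le), hcard e he]
    rw [hcard e he]
    refine lt_of_le_of_lt ?_ h1κ
    change #(e ∩ ⋃ j ∈ Iio (idx e), C j : Set V) ≤ aleph 1
    rw [biUnion_eq_iUnion, inter_iUnion]
    exact mk_iUnion_le_aleph_one_of_monotone (fun j : Iio (idx e) => e ∩ C j)
      (fun j k hjk => inter_subset_inter_right _ (hCmono hjk)) fun j => hidx' e he j j.2
  -- Induction applies to the remainders, not the edges; they keep size κ and finite intersections,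
  -- so the chain need not be continuous.
  obtain ⟨r, hr, hmax⟩ := ih _ (hCcard i) (C i)
    ((fun e => e \ ⋃ j < i, C j) '' {e | e ∈ E ∧ idx e = i}) (by
      rintro _ ⟨e, ⟨he, -⟩, rfl⟩ _ ⟨f, ⟨hf, -⟩, rfl⟩ hne
      refine (hE he hf ?_).subset (inter_subset_inter sdiff_subset sdiff_subset)
      rintro rfl
      exact hne rfl) (by
      rintro _ ⟨e, ⟨he, rfl⟩, rfl⟩
      exact htrace e he) (by
      rintro _ ⟨e, ⟨he, rfl⟩, rfl⟩
      exact sdiff_subset.trans (isEdgeClosed_edgeClosure E _ e he (hidx e he))) rfl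
  exact ⟨r, hr, fun e he hi => hmax _ ⟨e, ⟨he, hi⟩, rfl⟩⟩

/-! ### From maximizing well-orders to minimal covers -/

theorem PropertyC.pairwise_finite_inter {V : Type u} {E : Set (Set V)} (h : PropertyC E 2 ℵ₀) :
    E.Pairwise fun e f => (e ∩ f).Finite := by
  intro e he f hf hne
  have := h {e, f} (pair_subset he hf) (by
    rw [mk_insert (by simpa using hne), mk_singleton]
    norm_num [one_add_one_eq_two])
  rwa [sInter_pair, lt_aleph0_iff_set_finite] at this

/-- A set `Z` chosen greedily along a well-order: `x` is put into `Z` if it is the maximum of an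
edge that misses the part of `Z` chosen before `x`. -/
theorem exists_isMinimalVertexCover_of_isWellOrder {V : Type u} {E : Set (Set V)}
    {r : V → V → Prop} (hr : IsWellOrder V r)
    (hmax : ∀ e ∈ E, ∃ m ∈ e, ∀ x ∈ e, ¬ r m x) : ∃ Z, IsMinimalVertexCover E Z := by
  let Z : V → Prop := hr.wf.fix fun x Z =>
    ∃ e ∈ E, x ∈ e ∧ (∀ y ∈ e, ¬ r x y) ∧ ∀ y (hy : r y x), y ∈ e → ¬ Z y hy
  have hZ : ∀ x, Z x ↔ ∃ e ∈ E, x ∈ e ∧ (∀ y ∈ e, ¬ r x y) ∧ ∀ y, r y x → y ∈ e → ¬ Z y :=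
    fun x => iff_of_eq (hr.wf.fix_eq _ x)
  refine ⟨{x | Z x}, ⟨fun x hx => ?_, fun e he => ?_⟩, fun Z' hZ' hcov => ?_⟩
  · obtain ⟨e, he, hxe, -⟩ := (hZ x).1 hx
    exact ⟨e, he, hxe⟩
  · obtain ⟨m, hme, hm⟩ := hmax e he
    by_cases h : ∃ y ∈ e, Z y
    · obtain ⟨y, hy, hZy⟩ := h
      exact ⟨y, hZy, hy⟩
    · push Not at h
      exact ⟨m, (hZ m).2 ⟨e, he, hme, hm, fun y _ hy => h y hy⟩, hme⟩
  -- The edge that put `x` into `Z` meets `Z` only in `x`, so `x` cannot be dropped.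
  · obtain ⟨x, hx, hxZ'⟩ := exists_of_ssubset hZ'
    obtain ⟨e, he, hxe, hxm, hlt⟩ := (hZ x).1 hx
    obtain ⟨y, hyZ', hye⟩ := hcov.2 e he
    rcases trichotomous_of r x y with h | rfl | h
    · exact hxm y hye h
    · exact hxZ' hyZ'
    · exact hlt y h hye (hZ'.1 hyZ')

theorem exists_forall_not_rel_of_finite {V : Type*} {r : V → V → Prop} (hr : IsWellOrder V r)
    {e : Set V} (he : e.Finite) (hne : e.Nonempty) : ∃ m ∈ e, ∀ x ∈ e, ¬ r m x := by
  classical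
  let _ : LinearOrder V := linearOrderOfSTO r
  obtain ⟨m, hm, h⟩ := he.exists_maximal hne
  exact ⟨m, hm, fun x hx hmx => (h hx (le_of_lt hmx)).not_gt hmx⟩

end EdgeFamily

open EdgeFamily in
theorem mainTheorem2 (hGCH : EdgeFamily.GCH.{u}) (κ lam : Cardinal.{u})
    (hκ : Cardinal.aleph 2 ≤ κ) (hlam : κ ≤ lam) :
    EdgeFamily.MaxWO lam {κ} 2 Cardinal.aleph0 ∧
      EdgeFamily.MinVC lam (Set.Iio Cardinal.aleph0 ∪ {κ}) 2 Cardinal.aleph0 := by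
  constructor
  · intro V _ E _ hEκ hC
    obtain ⟨r, hr, hmax⟩ := exists_isWellOrder_of_subset hGCH hκ Set.univ E
      hC.pairwise_finite_inter (fun e he => hEκ he) fun e _ => Set.subset_univ e
    refine ⟨Subrel r (· ∈ ⋃₀ E), inferInstance, fun e he => ?_⟩
    obtain ⟨m, hm, h⟩ := hmax e he
    exact ⟨⟨m, e, he, hm⟩, hm, fun x hx => h x hx⟩
  · intro V _ E hE hEκ hC
    obtain ⟨r, hr, hmax⟩ := exists_isWellOrder_of_subset hGCH hκ Set.univ
      {e | e ∈ E ∧ Cardinal.mk e = κ} (hC.pairwise_finite_inter.mono fun e he => he.1)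
      (fun e he => he.2) fun e _ => Set.subset_univ e
    refine exists_isMinimalVertexCover_of_isWellOrder hr fun e he => ?_
    rcases hEκ he with hfin | hcard
    · exact exists_forall_not_rel_of_finite hr (Cardinal.lt_aleph0_iff_set_finite.1 hfin) (hE e he)
    · exact hmax e ⟨he, hcard⟩
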